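/- Let $P(\mathbb{Q})$ be the space of Borel probability measures on the rationals $\mathbb{Q}$ (with the usual topology), equipped with the weak topology. For $\mu\in P(\mathbb{Q})$ let $\operatorname{supp}(\mu)$ be the support of $\mu$, i.e. the closure in $\mathbb{Q}$ of $\{q\in\mathbb{Q}:\mu(\{q\})>0\}$. A set $S\subseteq P(\mathbb{Q})$ is uniformly tight if for every $\varepsilon>0$ there is a compact set $F\subseteq\mathbb{Q}$ with $\mu(\mathbb{Q}\setminus F)<\varepsilon$ for all $\mu\in S$; it is $\sigma$-uniformly tight if it is covered by countably many uniformly tight sets. Theorem. There exists a nonempty compact set $K\subseteq P(\mathbb{Q})$ such that (i) $\operatorname{supp}(\mu)$ is locally compact for every $\mu\in K$, and $\operatorname{supp}(\mu)\cap\operatorname{supp}(\nu)$ is finite for all distinct $\mu,\nu\in K$; (ii) every nonempty relatively open set $V\subseteq K$ contains a compact set $L$ such that, for every $\sigma$-uniformly tight set $A\subseteq K$, the set $L\setminus A$ contains a compact set which is not uniformly tight. -/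

import Mathlib

open MeasureTheory Set Topology

/-- A set of Borel probability measures on `E` is uniformly tight if for every `ε > 0` there is one
compact set whose complement has measure at most `ε` for all measures in the set. This is Mathlib's
`IsTightMeasureSet`, applied to the underlying measures. -/
def UniformlyTight {E : Type*} [TopologicalSpace E] [MeasurableSpace E]
    (S : Set (ProbabilityMeasure E)) : Prop :=
  IsTightMeasureSet {((μ : ProbabilityMeasure E) : Measure E) | μ ∈ S}

/-- A set of probability measures is σ-uniformly tight if it is covered by countably many uniformly
tight sets. -/
def SigmaUniformlyTight {E : Type*} [TopologicalSpace E] [MeasurableSpace E]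
    (A : Set (ProbabilityMeasure E)) : Prop :=
  ∃ S : ℕ → Set (ProbabilityMeasure E), (∀ n, UniformlyTight (S n)) ∧ A ⊆ ⋃ n, S n

/-- For a measure on the rationals, Mathlib's support is the closure of the set of atoms. -/
theorem support_eq_closure_atoms (μ : Measure ℚ) :
    μ.support = closure {q : ℚ | 0 < μ {q}} := by
  ext x
  rw [Measure.mem_support_iff_forall, mem_closure_iff_nhds]
  refine forall₂_congr fun U _ => ?_
  constructor
  · intro h
    by_contra hne
    refine h.ne' ((measure_null_iff_singleton U.to_countable).2 fun q hq => ?_)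
    by_contra h0
    exact hne ⟨q, hq, pos_iff_ne_zero.2 h0⟩
  · rintro ⟨q, hq, hpos⟩
    exact lt_of_lt_of_le hpos (measure_mono (singleton_subset_iff.2 hq))

/-! A bit sequence `x` drives particles in `[0, 1)`, all starting at position `0`; `law x` is the
distribution of their final positions, and `K` is the range of `law`. Blocks of particles wait on a
stack. Each bit moves the top block right by `2^{-code}`, where `code` is the binary numeral of the
bits read so far behind a leading 1, and then cuts it or leaves it there for good. The moves are
summable uniformly in `x`, so `law` is continuous (`continuous_law`) and `K` is compact.

A visited position has 2-adic valuation exactly `-code`, so it reveals the word read before it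
(`eq_of_loc_eq`); distinct sequences share only finitely many positions. From a time of minimal
later stack height on, all positions stay within `2 * 4^{-code}` to the right of a dyadic rational
with denominator `2^code`. As in Liouville's theorem, they therefore keep away from every rational
(`exists_le_abs_loc_sub`). So they form a closed discrete set containing the support, and a compact
set meets them at finitely many times only (`eventually_loc_notMem`).

This last fact gives control: cutting a block until the positions have left a compact set, and
resting the pieces from then on, puts the whole block outside that set. Given uniformly tight sets
`A n`, a block of width `w` is forced out of a compact set whose complement has mass at most `w / 2`
under `A n`, so the law is not in `A n` (`exists_width_le_law`). The forced blocks have small total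
mass, and the remaining free bits can still push a fixed amount of mass out of any compact set
(`exists_le_law_compl`). Hence the laws of the steered sequences, a compact family, are not
uniformly tight. -/

/-- A state of the particle process on `[0, 1)`. Particles in `[0, left)` are at rest. The active
block `[left, right)` sits at `base`; the list `pending` gives the right end and the position of
each further block, from left to right. -/
structure SplitState where
  code : ℕ
  left : ℝ
  right : ℝ
  base : ℚ
  pending : List (ℝ × ℚ)

namespace SplitState

/-- The position to which the active block moves next. -/
def loc (σ : SplitState) : ℚ := σ.base + (1 / 2) ^ σ.code

def width (σ : SplitState) : ℝ := σ.right - σ.left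

def stack (σ : SplitState) : List (ℝ × ℚ) := (σ.right, σ.base) :: σ.pending

/-- The code 1 is a leading binary digit: it makes later codes determine the number of bits read as
well as the bits. -/
def start : SplitState := ⟨1, 0, 1, 0, []⟩

/-- Move the active block and cut it into two halves. -/
noncomputable def split (σ : SplitState) (b : Bool) : SplitState :=
  ⟨2 * σ.code + b.toNat, σ.left, (σ.left + σ.right) / 2, σ.loc, (σ.right, σ.loc) :: σ.pending⟩

/-- The active block moves to `loc`. If the bit is `true` and other blocks are pending, the block
stays there for good; otherwise it is cut into halves. -/
noncomputable def step (σ : SplitState) (b : Bool) : SplitState :=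
  match b, σ.pending with
  | true, (e, p) :: l => ⟨2 * σ.code + 1, σ.right, e, p, l⟩
  | b, _ => σ.split b

theorem step_of_pending {σ : SplitState} {e : ℝ} {p : ℚ} {l : List (ℝ × ℚ)}
    (h : σ.pending = (e, p) :: l) : σ.step true = ⟨2 * σ.code + 1, σ.right, e, p, l⟩ := by
  simp [step, h]

theorem step_of_eq_nil {σ : SplitState} (h : σ.pending = []) (b : Bool) :
    σ.step b = σ.split b := by
  cases b <;> simp [step, h]

theorem step_false (σ : SplitState) : σ.step false = σ.split false := by
  simp [step]

theorem step_cases (σ : SplitState) (b : Bool) :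
    (σ.step b = σ.split b ∧ (b = false ∨ σ.pending = [])) ∨
      (b = true ∧ ∃ e p l, σ.pending = (e, p) :: l ∧
        σ.step b = ⟨2 * σ.code + 1, σ.right, e, p, l⟩) := by
  rcases b with _ | _
  · exact Or.inl ⟨step_false σ, Or.inl rfl⟩
  · rcases h : σ.pending with _ | ⟨⟨e, p⟩, l⟩
    · exact Or.inl ⟨step_of_eq_nil h _, Or.inr rfl⟩
    · exact Or.inr ⟨rfl, e, p, l, rfl, step_of_pending h⟩

theorem code_step (σ : SplitState) (b : Bool) : (σ.step b).code = 2 * σ.code + b.toNat := by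
  rcases step_cases σ b with ⟨h, -⟩ | ⟨rfl, e, p, l, -, h⟩ <;> rw [h] <;> rfl

/-! ### Descent of blocks -/

/-- The blocks in the list fill the interval from `r` to `e`, are of length at most `w`, and sit at
positions between `lo` and `hi`. -/
def Chain (w : ℝ) (lo hi : ℚ) : ℝ → List (ℝ × ℚ) → ℝ → Prop
  | r, [], e => r = e
  | r, (a, p) :: l, e => r < a ∧ a - r ≤ w ∧ lo ≤ p ∧ p ≤ hi ∧ Chain w lo hi a l e

theorem Chain.le {w : ℝ} {lo hi : ℚ} {l : List (ℝ × ℚ)} :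
    ∀ {r e : ℝ}, Chain w lo hi r l e → r ≤ e := by
  induction l with
  | nil => exact fun h => le_of_eq h
  | cons a l ih => exact fun h => h.1.le.trans (ih h.2.2.2.2)

theorem Chain.mono {w : ℝ} {lo hi hi' : ℚ} (hh : hi ≤ hi') {l : List (ℝ × ℚ)} :
    ∀ {r e : ℝ}, Chain w lo hi r l e → Chain w lo hi' r l e := by
  induction l with
  | nil => exact fun h => h
  | cons a l ih => exact fun h => ⟨h.1, h.2.1, h.2.2.1, h.2.2.2.1.trans hh, ih h.2.2.2.2⟩

/-- The active block of `σ` arose from that of `τ`, which has been cut. -/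
def Descends (τ σ : SplitState) : Prop :=
  ∃ A, A ≠ [] ∧ σ.stack = A ++ τ.pending ∧ τ.left ≤ σ.left ∧ 2 * τ.code ≤ σ.code ∧
    Chain (τ.width / 2) τ.loc (τ.loc + 2 * (1 / 2) ^ (2 * τ.code) - 2 * (1 / 2) ^ σ.code)
      σ.left A τ.right

theorem half_pow_le_half_pow {m n : ℕ} (h : m ≤ n) : (1 / 2 : ℚ) ^ n ≤ (1 / 2) ^ m :=
  pow_le_pow_of_le_one (by norm_num) (by norm_num) h

theorem descends_split {τ : SplitState} (hτ : τ.left < τ.right) (b : Bool) :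
    Descends τ (τ.split b) := by
  have h := half_pow_le_half_pow (show 2 * τ.code ≤ (τ.split b).code by simp [split])
  refine ⟨[((τ.left + τ.right) / 2, τ.loc), (τ.right, τ.loc)], by simp, by simp [split, stack],
    le_rfl, by simp [split], ?_⟩
  simp only [Chain, width, and_true, le_refl, true_and]
  simp only [split] at h ⊢
  refine ⟨by linarith, by linarith, by linarith, by linarith, by linarith, by linarith⟩

/-- The term `- 2 * (1 / 2) ^ σ.code` in the upper bound is a reserve for later moves. A move costs
`(1 / 2) ^ σ.code`, and since the code at least doubles, the bound rises by at least that much. The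
second alternative occurs when the last piece of the block of `τ` comes to rest. -/
theorem Descends.step {τ σ : SplitState} (h : Descends τ σ) (hc : 1 ≤ σ.code) (b : Bool) :
    Descends τ (σ.step b) ∨
      ((σ.step b).stack = τ.pending ∧ (σ.step b).left = τ.right) := by
  obtain ⟨A, hA, hst, hle, hcode, hch⟩ := h
  obtain ⟨⟨a, p⟩, A', rfl⟩ := List.exists_cons_of_ne_nil hA
  simp only [stack, List.cons_append, List.cons.injEq, Prod.mk.injEq] at hst
  obtain ⟨⟨rfl, rfl⟩, hp⟩ := hst
  obtain ⟨h1, h2, h3, h4, h5⟩ := hch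
  have hc' : 2 * σ.code ≤ (σ.step b).code := by rw [code_step]; omega
  have hpow : 2 * (1 / 2 : ℚ) ^ (σ.step b).code ≤ (1 / 2) ^ σ.code := by
    have := half_pow_le_half_pow (show σ.code + 1 ≤ (σ.step b).code by omega)
    rw [pow_succ] at this
    linarith
  have hpos : (0 : ℚ) < (1 / 2) ^ σ.code := by positivity
  have hmono : τ.loc + 2 * (1 / 2) ^ (2 * τ.code) - 2 * (1 / 2) ^ σ.code ≤
      τ.loc + 2 * (1 / 2) ^ (2 * τ.code) - 2 * (1 / 2) ^ (σ.step b).code := by linarith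
  rcases step_cases σ b with ⟨hs, -⟩ | ⟨rfl, e, p, l, hl, hs⟩
  · left
    refine ⟨((σ.left + σ.right) / 2, σ.loc) :: (σ.right, σ.loc) :: A', by simp, ?_, ?_,
      by omega, ?_⟩
    · simp [hs, split, stack, hp]
    · rw [hs]; exact hle
    · have hloc : σ.loc ≤
          τ.loc + 2 * (1 / 2) ^ (2 * τ.code) - 2 * (1 / 2) ^ (σ.step b).code := by
        simp only [loc] at *
        linarith
      have hloc' : τ.loc ≤ σ.loc := h3.trans (by simp only [loc]; linarith)
      rw [show (σ.step b).left = σ.left by rw [hs]; rfl]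
      refine ⟨by linarith, by linarith, hloc', hloc, by linarith, by linarith, hloc', hloc,
        h5.mono hmono⟩
  · rcases A' with _ | ⟨a', A'⟩
    · right
      rw [hs]
      refine ⟨?_, h5⟩
      simpa [stack, ← hl] using hp
    · left
      refine ⟨a' :: A', by simp, ?_, ?_, by omega, ?_⟩
      · rw [hs]
        simpa [stack, ← hl] using hp
      · rw [hs]
        exact hle.trans h1.le
      · have := h5.mono hmono
        rw [hs] at this ⊢
        exact this

theorem Descends.length_le {τ σ : SplitState} (h : Descends τ σ) :
    τ.pending.length ≤ σ.pending.length := by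
  obtain ⟨A, hA, hst, -⟩ := h
  have := congrArg List.length hst
  have hA' := List.length_pos_of_ne_nil hA
  simp only [stack, List.length_cons, List.length_append] at this
  omega

theorem Descends.bounds {τ σ : SplitState} (h : Descends τ σ) :
    τ.left ≤ σ.left ∧ σ.right ≤ τ.right ∧ σ.width ≤ τ.width / 2 ∧ τ.loc < σ.loc ∧
      σ.loc ≤ τ.loc + 2 * (1 / 2) ^ (2 * τ.code) := by
  obtain ⟨A, hA, hst, hle, hcode, hch⟩ := h
  obtain ⟨⟨a, p⟩, A', rfl⟩ := List.exists_cons_of_ne_nil hA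
  simp only [stack, List.cons_append, List.cons.injEq, Prod.mk.injEq] at hst
  obtain ⟨⟨rfl, rfl⟩, hp⟩ := hst
  obtain ⟨h1, h2, h3, h4, h5⟩ := hch
  have hpos : (0 : ℚ) < (1 / 2) ^ σ.code := by positivity
  refine ⟨hle, h5.le, h2, ?_, ?_⟩
  · rw [show σ.loc = σ.base + (1 / 2) ^ σ.code from rfl]
    linarith
  · rw [show σ.loc = σ.base + (1 / 2) ^ σ.code from rfl]
    linarith

/-! ### Runs, codes and the layout of the blocks -/

/-- The state after reading the first `k` bits of `x`. -/
noncomputable def run (x : ℕ → Bool) : ℕ → SplitState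
  | 0 => start
  | k + 1 => (run x k).step (x k)

theorem run_congr {x y : ℕ → Bool} {k : ℕ} (h : ∀ i < k, x i = y i) : run x k = run y k := by
  induction k with
  | zero => rfl
  | succ k ih =>
    rw [run, run, ih fun i hi => h i (hi.trans k.lt_succ_self), h k k.lt_succ_self]

theorem pow_le_code (x : ℕ → Bool) (k : ℕ) : 2 ^ k ≤ (run x k).code := by
  induction k with
  | zero => simp [run, start]
  | succ k ih => rw [run, code_step, pow_succ]; omega

theorem one_le_code (x : ℕ → Bool) (k : ℕ) : 1 ≤ (run x k).code :=
  Nat.one_le_two_pow.trans (pow_le_code x k)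

theorem le_code (x : ℕ → Bool) (k : ℕ) : k ≤ (run x k).code :=
  Nat.lt_two_pow_self.le.trans (pow_le_code x k)

theorem eq_of_code_eq {x y : ℕ → Bool} {k : ℕ} :
    ∀ {j : ℕ}, (run x k).code = (run y j).code → k = j ∧ ∀ i < k, x i = y i := by
  induction k with
  | zero =>
    rintro (_ | j) h
    · simp
    · have := pow_le_code y (j + 1)
      have h2 : 2 ≤ 2 ^ (j + 1) := by rw [pow_succ]; have := Nat.one_le_two_pow (n := j); omega
      simp only [run, start] at h this
      omega
  | succ k ih =>
    rintro (_ | j) h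
    · have := pow_le_code x (k + 1)
      have h2 : 2 ≤ 2 ^ (k + 1) := by rw [pow_succ]; have := Nat.one_le_two_pow (n := k); omega
      simp only [run, start] at h this
      omega
    · rw [run, run, code_step, code_step] at h
      have hb : (x k).toNat = (y j).toNat ∧ (run x k).code = (run y j).code := by
        have := (x k).toNat_le
        have := (y j).toNat_le
        omega
      obtain ⟨rfl, h'⟩ := ih hb.2
      refine ⟨rfl, fun i hi => ?_⟩
      rcases Nat.lt_succ_iff_lt_or_eq.1 hi with hi | rfl
      · exact h' i hi
      · have := hb.1
        revert this
        cases x i <;> cases y i <;> simp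

/-- The position of the particle `ω` after reading `k` bits. -/
noncomputable def pos (x : ℕ → Bool) : ℕ → ℝ → ℚ
  | 0, _ => 0
  | k + 1, ω =>
    open Classical in
    if ω ∈ Ico (run x k).left (run x k).right then (run x k).loc else pos x k ω

/-- The blocks in the list fill `[r, 1)`, and `f` gives their positions. -/
def Fills (f : ℝ → ℚ) : ℝ → List (ℝ × ℚ) → Prop
  | r, [] => r = 1
  | r, (e, p) :: l => r < e ∧ (∀ ω ∈ Ico r e, f ω = p) ∧ Fills f e l

theorem Fills.congr {f g : ℝ → ℚ} {l : List (ℝ × ℚ)} :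
    ∀ {r : ℝ}, (∀ ω, r ≤ ω → f ω = g ω) → Fills f r l → Fills g r l := by
  induction l with
  | nil => exact fun _ h => h
  | cons a l ih =>
    exact fun hfg h => ⟨h.1, fun ω hω => by rw [← hfg ω hω.1]; exact h.2.1 ω hω,
      ih (fun ω hω => hfg ω (h.1.le.trans hω)) h.2.2⟩

theorem Fills.le_one {f : ℝ → ℚ} {l : List (ℝ × ℚ)} : ∀ {r : ℝ}, Fills f r l → r ≤ 1 := by
  induction l with
  | nil => exact fun h => le_of_eq h
  | cons a l ih => exact fun h => h.1.le.trans (ih h.2.2)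

theorem fills_stack (x : ℕ → Bool) (k : ℕ) :
    Fills (pos x k) (run x k).left (run x k).stack := by
  induction k with
  | zero => simp [run, start, stack, Fills, pos]
  | succ k ih =>
    obtain ⟨h1, h2, h3⟩ := ih
    have h3' : Fills (pos x (k + 1)) (run x k).right (run x k).pending := by
      refine h3.congr fun ω hω => ?_
      simp [pos, hω.not_gt]
    have hq : ∀ ω ∈ Ico (run x k).left (run x k).right, pos x (k + 1) ω = (run x k).loc :=
      fun ω hω => by simp only [pos, if_pos hω]
    rcases step_cases (run x k) (x k) with ⟨hs, -⟩ | ⟨-, e, p, l, hl, hs⟩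
    · rw [run, hs]
      simp only [split, stack, Fills]
      exact ⟨by linarith, fun ω hω => hq ω ⟨hω.1, by linarith [hω.2]⟩, by linarith,
        fun ω hω => hq ω ⟨by linarith [hω.1], hω.2⟩, h3'⟩
    · rw [run, hs]
      rw [hl] at h3'
      exact h3'

theorem left_lt_right (x : ℕ → Bool) (k : ℕ) : (run x k).left < (run x k).right :=
  (fills_stack x k).1

theorem right_le_one (x : ℕ → Bool) (k : ℕ) : (run x k).right ≤ 1 := (fills_stack x k).2.2.le_one

theorem right_eq_one {x : ℕ → Bool} {k : ℕ} (h : (run x k).pending = []) :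
    (run x k).right = 1 := by
  have := (fills_stack x k).2.2
  rwa [h] at this

theorem left_le_succ (x : ℕ → Bool) (k : ℕ) : (run x k).left ≤ (run x (k + 1)).left := by
  rcases step_cases (run x k) (x k) with ⟨hs, -⟩ | ⟨-, e, p, l, hl, hs⟩
  · rw [run, hs]; rfl
  · rw [run, hs]; exact (left_lt_right x k).le

theorem monotone_left (x : ℕ → Bool) : Monotone fun k => (run x k).left :=
  monotone_nat_of_le_succ (left_le_succ x)

theorem left_nonneg (x : ℕ → Bool) (k : ℕ) : 0 ≤ (run x k).left :=
  monotone_left x (Nat.zero_le k)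

theorem left_lt_one (x : ℕ → Bool) (k : ℕ) : (run x k).left < 1 :=
  (left_lt_right x k).trans_le (right_le_one x k)

/-! ### 2-adic valuation of positions -/

/-- Positions on the stack are `0` or were created with a smaller code, so they are even multiples
of `2^{-code}`; adding one more `2^{-code}` makes the numerator odd. -/
theorem exists_loc_mul_pow_eq_odd (x : ℕ → Bool) (k : ℕ) :
    ∃ z : ℤ, (run x k).loc * 2 ^ (run x k).code = 2 * z + 1 := by
  suffices h : ∀ a ∈ (run x k).stack, ∃ z : ℤ, a.2 * 2 ^ (run x k).code = 2 * z by
    obtain ⟨z, hz⟩ := h ((run x k).right, (run x k).base) (by simp [stack])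
    refine ⟨z, ?_⟩
    rw [loc, add_mul, hz, ← mul_pow]
    norm_num
  induction k with
  | zero => exact fun a ha => ⟨0, by simp_all [run, start, stack]⟩
  | succ k ih =>
    obtain ⟨d, hd⟩ : ∃ d, (run x (k + 1)).code = (run x k).code + (d + 1) := by
      have := one_le_code x k
      refine ⟨(run x (k + 1)).code - (run x k).code - 1, ?_⟩
      rw [run, code_step]
      omega
    have hold : ∀ a ∈ (run x k).stack, ∃ z : ℤ, a.2 * 2 ^ (run x (k + 1)).code = 2 * z := by
      intro a ha
      obtain ⟨z, hz⟩ := ih a ha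
      refine ⟨z * 2 ^ (d + 1), ?_⟩
      rw [hd, pow_add, ← mul_assoc, hz]
      push_cast
      ring
    have hnew : ∃ z : ℤ, (run x k).loc * 2 ^ (run x (k + 1)).code = 2 * z := by
      obtain ⟨z, hz⟩ := ih ((run x k).right, (run x k).base) (by simp [stack])
      refine ⟨(2 * z + 1) * 2 ^ d, ?_⟩
      have h1 : (1 / 2 : ℚ) ^ (run x k).code * 2 ^ (run x k).code = 1 := by
        rw [← mul_pow]; norm_num
      rw [hd, pow_add, ← mul_assoc, loc, add_mul, hz, h1]
      push_cast
      ring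
    intro a ha
    rcases step_cases (run x k) (x k) with ⟨hs, -⟩ | ⟨-, e, p, l, hl, hs⟩
    · have ha' : a ∈ ((run x k).split (x k)).stack := by rwa [← hs]
      simp only [split, stack, List.mem_cons] at ha'
      rcases ha' with rfl | rfl | ha'
      · exact hnew
      · exact hnew
      · exact hold a (List.mem_cons_of_mem _ ha')
    · refine hold a (List.mem_cons_of_mem _ ?_)
      rw [run, hs] at ha
      rwa [hl]

theorem code_eq_of_loc_eq {x y : ℕ → Bool} {k j : ℕ} (h : (run x k).loc = (run y j).loc) :
    (run x k).code = (run y j).code := by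
  wlog hlt : (run x k).code ≤ (run y j).code generalizing x y k j
  · exact (this h.symm (le_of_not_ge hlt)).symm
  obtain ⟨a, ha⟩ := exists_loc_mul_pow_eq_odd x k
  obtain ⟨b, hb⟩ := exists_loc_mul_pow_eq_odd y j
  by_contra hne
  obtain ⟨d, hd⟩ := Nat.exists_eq_add_of_lt (lt_of_le_of_ne hlt hne)
  rw [← h, hd, add_assoc, pow_add, ← mul_assoc, ha, pow_succ] at hb
  have hb' : (2 * a + 1) * (2 ^ d * 2) = 2 * b + 1 := by exact_mod_cast hb
  have : 2 * ((2 * a + 1) * 2 ^ d) = 2 * b + 1 := by rw [← hb']; ring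
  omega

theorem eq_of_loc_eq {x y : ℕ → Bool} {k j : ℕ} (h : (run x k).loc = (run y j).loc) :
    k = j ∧ ∀ i < k, x i = y i :=
  eq_of_code_eq (code_eq_of_loc_eq h)

/-! ### Positions stay away from the rationals -/

/-- There are arbitrarily late times from which all later active blocks descend. -/
theorem exists_forall_descends (x : ℕ → Bool) (N : ℕ) :
    ∃ K ≥ N, ∀ j > K, Descends (run x K) (run x j) := by
  classical
  -- `K` minimizes the stack height among all times from `N` on. Bringing the whole block of time
  -- `K` to rest would lower the height further.
  have hne : ∃ m, ∃ K ≥ N, (run x K).pending.length = m := ⟨_, N, le_rfl, rfl⟩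
  obtain ⟨K, hK, hm⟩ := Nat.find_spec hne
  have hmin : ∀ j ≥ K, (run x K).pending.length ≤ (run x j).pending.length := fun j hj => by
    rw [hm]
    exact Nat.find_min' hne ⟨j, hK.trans hj, rfl⟩
  refine ⟨K, hK, fun j hj => ?_⟩
  induction j, hj using Nat.le_induction with
  | base =>
    rcases step_cases (run x K) (x K) with ⟨hs, -⟩ | ⟨-, e, p, l, hl, hs⟩
    · rw [run, hs]
      exact descends_split (left_lt_right x K) _
    · have := hmin (K + 1) K.le_succ
      rw [run, hs, hl] at this
      simp at this
  | succ j hj ih =>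
    rcases ih.step (one_le_code x j) (x j) with h | ⟨h, -⟩
    · exact h
    · have := hmin (j + 1) (by omega)
      have h' := congrArg List.length h
      rw [run] at this
      simp only [stack, List.length_cons] at h'
      omega

/-- Every time supplied by `exists_forall_descends` halves the bound on all later widths. -/
theorem eventually_width_lt (x : ℕ → Bool) {ε : ℝ} (hε : 0 < ε) :
    ∃ N, ∀ k ≥ N, (run x k).width < ε := by
  have h : ∀ n : ℕ, ∃ N, ∀ k ≥ N, (run x k).width ≤ (1 / 2) ^ n := by
    intro n
    induction n with
    | zero =>
      refine ⟨0, fun k _ => ?_⟩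
      have := left_nonneg x k
      have := right_le_one x k
      simp only [width, pow_zero]
      linarith
    | succ n ih =>
      obtain ⟨N, hN⟩ := ih
      obtain ⟨K, hK, hd⟩ := exists_forall_descends x N
      refine ⟨K + 1, fun k hk => (hd k hk).bounds.2.2.1.trans ?_⟩
      rw [pow_succ]
      linarith [hN K hK]
  obtain ⟨n, hn⟩ := exists_pow_lt_of_lt_one hε (show (1 / 2 : ℝ) < 1 by norm_num)
  obtain ⟨N, hN⟩ := h n
  exact ⟨N, fun k hk => (hN k hk).trans_lt hn⟩

/-- The sequence of positions stays away from every rational number. -/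
theorem exists_le_abs_loc_sub (x : ℕ → Bool) (c : ℚ) :
    ∃ δ > 0, ∃ N, ∀ k ≥ N, δ ≤ |(run x k).loc - c| := by
  -- Starting at `4 * c.den` ensures `4 * c.den ≤ 2 ^ n` for the code `n` at time `K`, as needed
  -- when `c` lies to the right.
  obtain ⟨K, hK, hd⟩ := exists_forall_descends x (4 * c.den)
  rcases le_or_gt c (run x K).loc with hc | hc
  · obtain ⟨K', hK', hd'⟩ := exists_forall_descends x (K + 1)
    have h1 := (hd K' hK').bounds.2.2.2.1
    refine ⟨(run x K').loc - c, by linarith, K' + 1, fun k hk => ?_⟩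
    have h2 := (hd' k hk).bounds.2.2.2.1
    exact le_trans (by linarith) (le_abs_self _)
  · obtain ⟨z, hz⟩ := exists_loc_mul_pow_eq_odd x K
    set n := (run x K).code with hn
    have hden : (0 : ℚ) < c.den := by exact_mod_cast c.den_pos
    have hpow : (0 : ℚ) < 2 ^ n := by positivity
    -- The Liouville estimate: `c` differs from a dyadic with denominator `2 ^ n` by at least `1 /
    -- (c.den * 2 ^ n)`, whereas later positions advance by at most `2 * 4^{-n}`, which is at most
    -- half of the gap.
    have hgap : 1 ≤ (c - (run x K).loc) * (c.den * 2 ^ n) := by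
      have h0 : 0 < (c - (run x K).loc) * (c.den * 2 ^ n) := by
        have : 0 < c - (run x K).loc := by linarith
        positivity
      have h1 : (c - (run x K).loc) * (c.den * 2 ^ n) =
          ((c.num * 2 ^ n - c.den * (2 * z + 1) : ℤ) : ℚ) := by
        push_cast
        rw [← hz, ← Rat.mul_den_eq_num c]
        ring
      rw [h1] at h0 ⊢
      exact_mod_cast h0
    have hbig : 4 * (c.den : ℚ) ≤ 2 ^ n := by
      have : 4 * c.den ≤ 2 ^ n := (hK.le.trans (le_code x K)).trans Nat.lt_two_pow_self.le
      exact_mod_cast this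
    have hsq : (1 / 2 : ℚ) ^ (2 * n) * (2 ^ n * 2 ^ n) = 1 := by
      rw [two_mul, ← pow_add, ← mul_pow]
      norm_num
    refine ⟨(c - (run x K).loc) / 2, by linarith, K + 1, fun k hk => ?_⟩
    have h2 := (hd k hk).bounds.2.2.2.2
    rw [← hn] at h2
    have h3 : 2 * (1 / 2 : ℚ) ^ (2 * n) ≤ (c - (run x K).loc) / 2 := by
      have h4 : 4 * (1 / 2 : ℚ) ^ (2 * n) * (c.den * 2 ^ n) ≤ 1 := by
        calc 4 * (1 / 2 : ℚ) ^ (2 * n) * (c.den * 2 ^ n)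
            = (1 / 2 : ℚ) ^ (2 * n) * (4 * c.den * 2 ^ n) := by ring
          _ ≤ (1 / 2 : ℚ) ^ (2 * n) * (2 ^ n * 2 ^ n) := by gcongr
          _ = 1 := hsq
      have h5 := le_of_mul_le_mul_right (h4.trans hgap) (by positivity)
      linarith
    rw [abs_sub_comm]
    exact le_trans (by linarith) (le_abs_self _)

/-- A compact set contains only finitely many of the positions. -/
theorem eventually_loc_notMem (x : ℕ → Bool) {F : Set ℚ} (hF : IsCompact F) :
    ∃ N, ∀ k ≥ N, (run x k).loc ∉ F := by
  choose δ hδ N hN using exists_le_abs_loc_sub x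
  obtain ⟨t, -, ht⟩ := hF.elim_nhds_subcover (fun c => Metric.ball c (δ c))
    fun c _ => Metric.ball_mem_nhds c (by exact_mod_cast hδ c)
  refine ⟨t.sup N, fun k hk hmem => ?_⟩
  obtain ⟨c, hc, hball⟩ := mem_iUnion₂.1 (ht hmem)
  have h1 := hN c k ((Finset.le_sup hc).trans hk)
  rw [Metric.mem_ball, Rat.dist_eq] at hball
  have h2 : |(run x k).loc - c| < δ c := by exact_mod_cast hball
  exact absurd h1 (not_le.2 h2)

end SplitState

namespace SplitState
open Filter

/-! ### Final positions and their laws -/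

/-- The move at time `k` has length at most `2^{-k}` because `k ≤ code`; the bound is the geometric
tail, uniform in `x` and `ω`. -/
theorem pos_bounds (x : ℕ → Bool) (N i : ℕ) (ω : ℝ) :
    pos x N ω ≤ pos x (N + i) ω ∧
      pos x (N + i) ω ≤ pos x N ω + 2 * (1 / 2) ^ N - 2 * (1 / 2) ^ (N + i) := by
  induction i with
  | zero => simp
  | succ i ih =>
    have hpos : (0 : ℚ) < (1 / 2) ^ (N + i) := by positivity
    have hs : 2 * (1 / 2 : ℚ) ^ (N + (i + 1)) = (1 / 2) ^ (N + i) := by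
      rw [← add_assoc, pow_succ]; ring
    rw [hs, ← add_assoc, pos]
    split_ifs with h
    · have hb : pos x (N + i) ω = (run x (N + i)).base := (fills_stack x (N + i)).2.1 ω h
      have hc := half_pow_le_half_pow (le_code x (N + i))
      have hc' : (0 : ℚ) < (1 / 2) ^ (run x (N + i)).code := by positivity
      rw [loc, ← hb]
      constructor <;> linarith [ih.1, ih.2]
    · constructor <;> linarith [ih.1, ih.2]

theorem measurable_pos (x : ℕ → Bool) (k : ℕ) : Measurable (pos x k) := by
  induction k with
  | zero => exact measurable_const
  | succ k ih =>
    classical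
    have : pos x (k + 1) = fun ω =>
        if ω ∈ Ico (run x k).left (run x k).right then (run x k).loc else pos x k ω := by
      funext ω
      simp [pos]
    rw [this]
    exact Measurable.ite measurableSet_Ico measurable_const ih

theorem pos_eq_of_forall_notMem {x : ℕ → Bool} {N : ℕ} {ω : ℝ}
    (h : ∀ k ≥ N, ω ∉ Ico (run x k).left (run x k).right) : ∀ k ≥ N, pos x k ω = pos x N ω := by
  intro k hk
  induction k, hk using Nat.le_induction with
  | base => rfl
  | succ k hk ih => rw [pos, if_neg (h k hk), ih]

/-- Almost every particle moves only finitely often. -/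
theorem ae_exists_forall_notMem (x : ℕ → Bool) :
    ∀ᵐ ω : ℝ, ∃ N, ∀ k ≥ N, ω ∉ Ico (run x k).left (run x k).right := by
  -- Two particles that both move forever lie in a common block at some arbitrarily late descent
  -- time. Widths tend to `0`, so at most one such particle exists.
  refine Set.Subsingleton.measure_zero (fun ω hω ω' hω' => ?_) volume
  have key : ∀ {ω : ℝ}, (¬ ∃ N, ∀ k ≥ N, ω ∉ Ico (run x k).left (run x k).right) →
      ∀ N, ∃ K ≥ N, ω ∈ Ico (run x K).left (run x K).right ∧
        ∀ j > K, Descends (run x K) (run x j) := by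
    intro ω hω N
    obtain ⟨K, hK, hd⟩ := exists_forall_descends x N
    push Not at hω
    obtain ⟨j, hj, hm⟩ := hω (K + 1)
    have hb := (hd j hj).bounds
    exact ⟨K, hK, ⟨hb.1.trans hm.1, hm.2.trans_le hb.2.1⟩, hd⟩
  by_contra hne
  have hpos : 0 < |ω - ω'| := abs_pos.2 (sub_ne_zero.2 hne)
  obtain ⟨N, hN⟩ := eventually_width_lt x hpos
  obtain ⟨K, hK, hm, hd⟩ := key hω N
  obtain ⟨K', hK', hm', -⟩ := key hω' (K + 1)
  have hb := (hd K' hK').bounds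
  have hw := hN K hK
  have h1 := hm'.1
  have h2 := hm'.2
  rw [width] at hw
  refine absurd hw (not_lt.2 (abs_le.2 ⟨?_, ?_⟩)) <;> linarith [hm.1, hm.2, hb.1, hb.2.1]

theorem exists_measurable_limit (x : ℕ → Bool) : ∃ f : ℝ → ℚ, Measurable f ∧
    ∀ᵐ ω : ℝ, Tendsto (fun k => pos x k ω) atTop (𝓝 (f ω)) := by
  refine measurable_limit_of_tendsto_metrizable_ae (fun k => (measurable_pos x k).aemeasurable) ?_
  filter_upwards [ae_exists_forall_notMem x] with ω ⟨N, hN⟩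
  exact ⟨pos x N ω, tendsto_atTop_of_eventually_const (pos_eq_of_forall_notMem hN)⟩

/-- The final position of a particle. -/
noncomputable def finalPos (x : ℕ → Bool) : ℝ → ℚ := (exists_measurable_limit x).choose

theorem measurable_finalPos (x : ℕ → Bool) : Measurable (finalPos x) :=
  (exists_measurable_limit x).choose_spec.1

theorem ae_pos_eq_finalPos (x : ℕ → Bool) :
    ∀ᵐ ω : ℝ, ∃ N, (∀ k ≥ N, ω ∉ Ico (run x k).left (run x k).right) ∧
      ∀ k ≥ N, pos x k ω = finalPos x ω := by
  filter_upwards [ae_exists_forall_notMem x, (exists_measurable_limit x).choose_spec.2]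
    with ω ⟨N, hN⟩ hω
  have h := pos_eq_of_forall_notMem hN
  have : finalPos x ω = pos x N ω :=
    tendsto_nhds_unique hω (tendsto_atTop_of_eventually_const h)
  exact ⟨N, hN, fun k hk => by rw [this, h k hk]⟩

/-- Particles are distributed uniformly on `[0, 1)`. -/
noncomputable def particles : ProbabilityMeasure ℝ :=
  ⟨volume.restrict (Ico 0 1), ⟨by simp⟩⟩

theorem coe_particles : (particles : Measure ℝ) = volume.restrict (Ico 0 1) := rfl

theorem ae_particles {p : ℝ → Prop} (h : ∀ᵐ ω : ℝ, p ω) : ∀ᵐ ω ∂(particles : Measure ℝ), p ω :=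
  ae_restrict_of_ae h

/-- The distribution of the final position. -/
noncomputable def law (x : ℕ → Bool) : ProbabilityMeasure ℚ :=
  particles.map (measurable_finalPos x).aemeasurable

theorem coe_law (x : ℕ → Bool) :
    (law x : Measure ℚ) = (particles : Measure ℝ).map (finalPos x) := rfl

theorem law_apply (x : ℕ → Bool) (s : Set ℚ) :
    (law x : Measure ℚ) s = (particles : Measure ℝ) (finalPos x ⁻¹' s) := by
  rw [coe_law, Measure.map_apply (measurable_finalPos x) (by trivial)]

/-- If the particle is passed over by the frontier at time `k`, then it stays at `loc`. -/
theorem ae_finalPos_eq_loc (x : ℕ → Bool) : ∀ᵐ ω : ℝ, ∀ k,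
    ω ∈ Ico (run x k).left (run x (k + 1)).left → finalPos x ω = (run x k).loc := by
  filter_upwards [ae_pos_eq_finalPos x] with ω ⟨N, hN, hpos⟩ k hk
  have hmem : ω ∈ Ico (run x k).left (run x k).right := by
    refine ⟨hk.1, ?_⟩
    rcases step_cases (run x k) (x k) with ⟨hs, -⟩ | ⟨-, e, p, l, hl, hs⟩
    · have := hk.2
      rw [run, hs] at this
      exact absurd hk.1 (not_le.2 this)
    · have := hk.2
      rwa [run, hs] at this
  have hout : ∀ j ≥ k + 1, ω ∉ Ico (run x j).left (run x j).right := fun j hj hm =>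
    absurd (hm.1.trans_lt hk.2) (not_lt.2 (monotone_left x hj))
  have h := pos_eq_of_forall_notMem hout (max N (k + 1)) (le_max_right _ _)
  rw [← hpos (max N (k + 1)) (le_max_left _ _), h, pos, if_pos hmem]

/-- The intervals swept by the frontier `left` are disjoint, and almost all particles in the `k`-th
one end at the `k`-th `loc`. Times at which the frontier does not move contribute nothing. -/
theorem sum_le_law_compl (x : ℕ → Bool) {F : Set ℚ} {G : Finset ℕ}
    (hG : ∀ k ∈ G, (run x k).left < (run x (k + 1)).left → (run x k).loc ∉ F) :
    ENNReal.ofReal (∑ k ∈ G, ((run x (k + 1)).left - (run x k).left)) ≤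
      (law x : Measure ℚ) Fᶜ := by
  have hmono := monotone_left x
  calc ENNReal.ofReal (∑ k ∈ G, ((run x (k + 1)).left - (run x k).left))
      = ∑ k ∈ G, volume (Ico (run x k).left (run x (k + 1)).left) := by
        rw [ENNReal.ofReal_sum_of_nonneg fun k _ => sub_nonneg.2 (left_le_succ x k)]
        simp only [Real.volume_Ico]
    _ = volume (⋃ k ∈ G, Ico (run x k).left (run x (k + 1)).left) :=
        (measure_biUnion_finset ((hmono.pairwise_disjoint_on_Ico_succ).set_pairwise _)
          fun _ _ => measurableSet_Ico).symm
    _ ≤ (law x : Measure ℚ) Fᶜ := by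
        rw [law_apply, coe_particles, Measure.restrict_apply
          (measurable_finalPos x (show MeasurableSet Fᶜ by trivial))]
        refine measure_mono_ae ?_
        filter_upwards [ae_finalPos_eq_loc x] with ω hω hmem
        obtain ⟨k, hk, hm⟩ := mem_iUnion₂.1 hmem
        refine ⟨?_, (left_nonneg x k).trans hm.1, hm.2.trans (left_lt_one x _)⟩
        have := hG k hk (hm.1.trans_lt hm.2)
        rwa [← hω k hm] at this

theorem ae_finalPos_mem_range (x : ℕ → Bool) :
    ∀ᵐ ω ∂(particles : Measure ℝ), finalPos x ω ∈ range fun k => (run x k).loc := by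
  filter_upwards [ae_particles (ae_pos_eq_finalPos x),
    ae_restrict_mem (μ := volume) (measurableSet_Ico (a := (0 : ℝ)) (b := 1))]
    with ω ⟨N, _, hN⟩ hω
  -- The index starts at 1 because the first bit moves all of `[0, 1)` away from the initial
  -- position `0`.
  have h : ∀ k, pos x (k + 1) ω ∈ range fun k => (run x k).loc := by
    intro k
    induction k with
    | zero =>
      refine ⟨0, ?_⟩
      rw [pos, if_pos]
      simpa [run, start] using hω
    | succ k ih =>
      rw [pos]
      split_ifs
      · exact ⟨k + 1, rfl⟩
      · exact ih
  rw [← hN (N + 1) N.le_succ]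
  exact h N

/-! ### Supports -/

theorem exists_nhds_finite_inter_range (x : ℕ → Bool) (c : ℚ) :
    ∃ U ∈ 𝓝 c, (U ∩ range fun k => (run x k).loc).Finite := by
  obtain ⟨δ, hδ, N, hN⟩ := exists_le_abs_loc_sub x c
  refine ⟨Metric.ball c δ, Metric.ball_mem_nhds c (by exact_mod_cast hδ),
    ((finite_Iio N).image fun k => (run x k).loc).subset ?_⟩
  rintro _ ⟨hb, k, rfl⟩
  refine ⟨k, not_le.1 fun hk => absurd (hN k hk) (not_le.2 ?_), rfl⟩
  rw [Metric.mem_ball, Rat.dist_eq] at hb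
  exact_mod_cast hb

theorem isClosed_range_loc (x : ℕ → Bool) : IsClosed (range fun k => (run x k).loc) := by
  refine isClosed_of_closure_subset fun c hc => ?_
  obtain ⟨U, hU, hfin⟩ := exists_nhds_finite_inter_range x c
  have h : c ∈ closure (U ∩ range fun k => (run x k).loc) :=
    mem_closure_iff_nhds.2 fun V hV => by
      rw [← inter_assoc]
      exact mem_closure_iff_nhds.1 hc _ (Filter.inter_mem hV hU)
  rw [hfin.isClosed.closure_eq] at h
  exact h.2

theorem support_law_subset (x : ℕ → Bool) :
    (law x : Measure ℚ).support ⊆ range fun k => (run x k).loc := by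
  refine Measure.support_subset_of_isClosed (isClosed_range_loc x) ?_
  rw [mem_ae_iff, law_apply]
  exact ae_finalPos_mem_range x

theorem discreteTopology_support_law (x : ℕ → Bool) :
    DiscreteTopology (law x : Measure ℚ).support := by
  refine discreteTopology_subtype_iff'.2 fun c hc => ?_
  obtain ⟨U, hU, hfin⟩ := exists_nhds_finite_inter_range x c
  have hfin' : ((U ∩ range fun k => (run x k).loc) \ {c}).Finite := hfin.subset sdiff_subset
  obtain ⟨V, hVU, hV, hcV⟩ := mem_nhds_iff.1
    (Filter.inter_mem hU (hfin'.isClosed.isOpen_compl.mem_nhds (by simp)))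
  refine ⟨V, hV, Subset.antisymm (fun d hd => ?_) (by simpa using ⟨hcV, hc⟩)⟩
  by_contra hne
  exact (hVU hd.1).2 ⟨⟨(hVU hd.1).1, support_law_subset x hd.2⟩, hne⟩

theorem finite_inter_support_law {x y : ℕ → Bool} (h : x ≠ y) :
    ((law x : Measure ℚ).support ∩ (law y : Measure ℚ).support).Finite := by
  obtain ⟨i, hi⟩ := Function.ne_iff.1 h
  refine ((finite_Iic i).image fun k => (run x k).loc).subset ?_
  rintro c ⟨hx, hy⟩
  obtain ⟨k, rfl⟩ := support_law_subset x hx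
  obtain ⟨j, hj⟩ := support_law_subset y hy
  refine ⟨k, mem_Iic.2 (not_lt.1 fun hk => hi ?_), rfl⟩
  exact (eq_of_loc_eq hj.symm).2 i hk

/-! ### Continuity of the law -/

/-- Once `u n` shares `M` bits with `x`, the particle is at the same place at time `M`. If it has
already settled for `x`, then under `u n` it ends to the right of that place by at most `2 *
2^{-M}`. -/
theorem tendsto_finalPos {x : ℕ → Bool} {u : ℕ → ℕ → Bool} (hu : Tendsto u atTop (𝓝 x)) :
    ∀ᵐ ω : ℝ, Tendsto (fun n => finalPos (u n) ω) atTop (𝓝 (finalPos x ω)) := by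
  filter_upwards [ae_pos_eq_finalPos x, ae_all_iff.2 fun n => ae_pos_eq_finalPos (u n)]
    with ω ⟨N, _, hN⟩ hω
  rw [Metric.tendsto_atTop]
  intro ε hε
  obtain ⟨m, hm⟩ := exists_pow_lt_of_lt_one (half_pos hε) (show (1 / 2 : ℝ) < 1 by norm_num)
  set M := max N m
  have hagree : ∀ᶠ n in atTop, ∀ i < M, u n i = x i := by
    refine (Filter.eventually_all_finite (finite_Iio M)).2 fun i _ => ?_
    have := (tendsto_pi_nhds.1 hu i)
    rw [nhds_discrete, tendsto_pure] at this
    exact this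
  obtain ⟨n₀, hn₀⟩ := eventually_atTop.1 hagree
  refine ⟨n₀, fun n hn => ?_⟩
  have hpos : ∀ k ≤ M, pos (u n) k ω = pos x k ω := by
    intro k
    induction k with
    | zero => exact fun _ => rfl
    | succ k ih =>
      intro hk
      rw [pos, pos, ih (by omega), run_congr fun i hi => hn₀ n hn i (by omega)]
  obtain ⟨N', -, hN'⟩ := hω n
  obtain ⟨h1, h2⟩ := pos_bounds (u n) M N' ω
  rw [hN' (M + N') (by omega), hpos M le_rfl, hN M (le_max_left _ _)] at h1 h2
  have h3 : (0 : ℚ) < (1 / 2) ^ (M + N') := by positivity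
  have h4 : (1 / 2 : ℝ) ^ M ≤ (1 / 2) ^ m :=
    pow_le_pow_of_le_one (by norm_num) (by norm_num) (le_max_right _ _)
  have h5 : finalPos (u n) ω - finalPos x ω ≤ 2 * (1 / 2) ^ M := by linarith
  have h5' : (finalPos (u n) ω : ℝ) - finalPos x ω ≤ 2 * (1 / 2) ^ M := by
    have : ((finalPos (u n) ω - finalPos x ω : ℚ) : ℝ) ≤ ((2 * (1 / 2) ^ M : ℚ) : ℝ) := by
      exact_mod_cast h5
    push_cast at this
    exact this
  have h1' : (finalPos x ω : ℝ) ≤ finalPos (u n) ω := by exact_mod_cast h1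
  rw [Rat.dist_eq, abs_of_nonneg (by linarith)]
  linarith

theorem continuous_law : Continuous law := by
  refine continuous_iff_seqContinuous.2 fun u x hu => ?_
  rw [ProbabilityMeasure.tendsto_iff_forall_integral_tendsto]
  intro f
  have hint : ∀ y, ∫ q, f q ∂(law y : Measure ℚ) =
      ∫ ω, f (finalPos y ω) ∂(particles : Measure ℝ) := fun y => by
    rw [coe_law, integral_map (measurable_finalPos y).aemeasurable
      f.continuous.aestronglyMeasurable]
  simp only [Function.comp_apply, hint]
  refine tendsto_integral_of_dominated_convergence (fun _ => ‖f‖)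
    (fun n => (f.continuous.measurable.comp (measurable_finalPos _)).aestronglyMeasurable)
    (integrable_const _) (fun n => ae_of_all _ fun ω => f.norm_coe_le_norm _) ?_
  filter_upwards [ae_particles (tendsto_finalPos hu)] with ω hω
  exact (f.continuous.tendsto _).comp hω

end SplitState

namespace SplitState

theorem step_of_eq_or_descends {τ σ : SplitState} (h : τ = σ ∨ Descends τ σ) (hc : 1 ≤ σ.code)
    (hlt : σ.left < σ.right) (b : Bool) :
    Descends τ (σ.step b) ∨ ((σ.step b).stack = τ.pending ∧ (σ.step b).left = τ.right) := by
  rcases h with rfl | h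
  · rcases step_cases τ b with ⟨hs, -⟩ | ⟨-, e, p, l, hl, hs⟩
    · rw [hs]
      exact Or.inl (descends_split hlt b)
    · rw [hs, hl]
      exact Or.inr ⟨rfl, rfl⟩
  · exact h.step hc b

end SplitState

/-! ### Steering with forced blocks -/

/-- Data for steering the particle process: after the first `time` bits of `init` the bits are
free, except that the `n`-th time an active block of length `w ≤ threshold n` is met, this block is
first brought to rest outside `target n w`. -/
structure Steering where
  threshold : ℕ → ℝ
  target : ℕ → ℝ → Set ℚ
  init : ℕ → Bool
  time : ℕ

/-- A state of the process, the number of blocks already brought to rest by force, and the state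
in which the current forced block was met, if there is one. -/
structure ControlState where
  cur : SplitState
  count : ℕ
  phase : Option SplitState

namespace Steering

open SplitState

variable (S : Steering)

-- The condition on `pending` is needed because the last block on the stack cannot be brought to
-- rest: it is cut whatever the bit.
open Classical in
noncomputable def active (a : ControlState) : Option SplitState :=
  match a.phase with
  | some τ => some τ
  | none => if a.cur.width ≤ S.threshold a.count ∧ a.cur.pending ≠ [] then some a.cur else none

-- While a block is being forced, the free bit is ignored and a piece rests exactly when it lands
-- outside the target.
open Classical in
noncomputable def bit (a : ControlState) (b : Bool) : Bool :=
  match S.active a with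
  | none => b
  | some τ => decide (a.cur.loc ∉ S.target a.count τ.width)

/-- The stack height detects the end of a phase: `pending` becomes shorter than `τ.pending` exactly
when all pieces of the block of `τ` are at rest. -/
noncomputable def next (a : ControlState) (b : Bool) : ControlState :=
  match S.active a with
  | none => ⟨a.cur.step (S.bit a b), a.count, none⟩
  | some τ =>
    if (a.cur.step (S.bit a b)).pending.length < τ.pending.length then
      ⟨a.cur.step (S.bit a b), a.count + 1, none⟩
    else ⟨a.cur.step (S.bit a b), a.count, some τ⟩

theorem cur_next (a : ControlState) (b : Bool) :
    (S.next a b).cur = a.cur.step (S.bit a b) := by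
  unfold next
  split
  · rfl
  · split_ifs <;> rfl

theorem next_of_active_eq_none {a : ControlState} (h : S.active a = none) (b : Bool) :
    S.next a b = ⟨a.cur.step b, a.count, none⟩ := by
  simp [next, bit, h]

theorem phase_eq_none_of_active_eq_none {a : ControlState} (h : S.active a = none) :
    a.phase = none := by
  unfold active at h
  split at h
  · simp at h
  · assumption

theorem active_of_phase_eq_none {a : ControlState} (h : a.phase = none) {τ : SplitState}
    (ha : S.active a = some τ) :
    τ = a.cur ∧ a.cur.width ≤ S.threshold a.count ∧ a.cur.pending ≠ [] := by
  simp only [active, h] at ha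
  split_ifs at ha with h'
  exact ⟨(Option.some.inj ha).symm, h'⟩

theorem active_of_phase_eq_some {a : ControlState} {τ : SplitState} (h : a.phase = some τ) :
    S.active a = some τ := by
  simp [active, h]

noncomputable def control (y : ℕ → Bool) : ℕ → ControlState
  | 0 => ⟨run S.init S.time, 0, none⟩
  | k + 1 => S.next (control y k) (y k)

/-- The bits that result from the free bits `y`. -/
noncomputable def steer (y : ℕ → Bool) (k : ℕ) : Bool :=
  if k < S.time then S.init k
  else S.bit (S.control y (k - S.time)) (y (k - S.time))

theorem run_steer (y : ℕ → Bool) (i : ℕ) :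
    run (S.steer y) (S.time + i) = (S.control y i).cur := by
  induction i with
  | zero => exact run_congr fun i hi => if_pos hi
  | succ i ih =>
    rw [← add_assoc, run, ih, control, cur_next]
    simp [steer]

theorem continuous_steer : Continuous S.steer := by
  -- Each control state depends on finitely many free bits, so it is continuous even for the
  -- discrete topology.
  let _ : TopologicalSpace ControlState := ⊥
  have _ : DiscreteTopology ControlState := ⟨rfl⟩
  have hc : ∀ i, Continuous fun y => S.control y i := by
    intro i
    induction i with
    | zero => exact continuous_const
    | succ i ih =>
      exact (continuous_of_discreteTopology
        (f := fun p : ControlState × Bool => S.next p.1 p.2)).comp (ih.prodMk (continuous_apply i))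
  refine continuous_pi fun k => ?_
  by_cases hk : k < S.time
  · simp only [steer, if_pos hk]
    exact continuous_const
  · simp only [steer, if_neg hk]
    exact (continuous_of_discreteTopology (f := fun p : ControlState × Bool => S.bit p.1 p.2)).comp
      ((hc _).prodMk (continuous_apply _))

theorem left_lt_right_control (y : ℕ → Bool) (i : ℕ) :
    (S.control y i).cur.left < (S.control y i).cur.right := by
  rw [← run_steer]
  exact left_lt_right _ _

theorem one_le_code_control (y : ℕ → Bool) (i : ℕ) : 1 ≤ (S.control y i).cur.code := by
  rw [← run_steer]
  exact one_le_code _ _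

theorem control_succ_cases {y : ℕ → Bool} {i : ℕ} {τ : SplitState}
    (ha : S.active (S.control y i) = some τ)
    (hd : τ = (S.control y i).cur ∨ Descends τ (S.control y i).cur) :
    ((S.control y (i + 1)).phase = some τ ∧
        (S.control y (i + 1)).count = (S.control y i).count ∧
        Descends τ (S.control y (i + 1)).cur) ∨
      ((S.control y (i + 1)).phase = none ∧
        (S.control y (i + 1)).count = (S.control y i).count + 1 ∧
        (S.control y (i + 1)).cur.stack = τ.pending ∧
        (S.control y (i + 1)).cur.left = τ.right) := by
  have hcur : (S.control y (i + 1)).cur =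
      (S.control y i).cur.step (S.bit (S.control y i) (y i)) := cur_next S _ _
  have hs := step_of_eq_or_descends hd (S.one_le_code_control y i) (S.left_lt_right_control y i)
    (S.bit (S.control y i) (y i))
  rw [← hcur] at hs
  rcases hs with hs | ⟨hs, hl⟩
  · have hn : ¬ (S.control y (i + 1)).cur.pending.length < τ.pending.length :=
      not_lt.2 hs.length_le
    rw [hcur] at hn
    refine Or.inl ⟨?_, ?_, hs⟩ <;> simp [control, next, ha, hn]
  · have hn : (S.control y (i + 1)).cur.pending.length < τ.pending.length := by
      rw [← hs]
      simp [stack]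
    rw [hcur] at hn
    refine Or.inr ⟨?_, ?_, hs, hl⟩ <;> simp [control, next, ha, hn]

theorem control_succ_of_active_eq_none {y : ℕ → Bool} {i : ℕ}
    (h : S.active (S.control y i) = none) :
    S.control y (i + 1) = ⟨(S.control y i).cur.step (y i), (S.control y i).count, none⟩ :=
  S.next_of_active_eq_none h (y i)

theorem active_spec (y : ℕ → Bool) (i : ℕ) {τ : SplitState}
    (h : S.active (S.control y i) = some τ) :
    (τ = (S.control y i).cur ∨ Descends τ (S.control y i).cur) ∧
      τ.width ≤ S.threshold (S.control y i).count ∧ τ.pending ≠ [] := by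
  induction i generalizing τ with
  | zero =>
    obtain ⟨rfl, h1, h2⟩ := S.active_of_phase_eq_none rfl h
    exact ⟨Or.inl rfl, h1, h2⟩
  | succ i ih =>
    rcases hp : (S.control y (i + 1)).phase with _ | τ'
    · obtain ⟨rfl, h1, h2⟩ := S.active_of_phase_eq_none hp h
      exact ⟨Or.inl rfl, h1, h2⟩
    · obtain rfl : τ' = τ := Option.some.inj ((S.active_of_phase_eq_some hp).symm.trans h)
      rcases ha : S.active (S.control y i) with _ | τ
      · rw [S.control_succ_of_active_eq_none ha] at hp
        simp at hp
      · obtain ⟨h1, h2, h3⟩ := ih ha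
        rcases S.control_succ_cases ha h1 with ⟨h4, h5, h6⟩ | ⟨h4, -⟩
        · obtain rfl : τ = τ' := Option.some.inj (h4.symm.trans hp)
          exact ⟨Or.inr h6, by rwa [h5], h3⟩
        · simp [hp] at h4

theorem pending_ne_nil_of_active {y : ℕ → Bool} {i : ℕ} {τ : SplitState}
    (h : S.active (S.control y i) = some τ) : (S.control y i).cur.pending ≠ [] := by
  obtain ⟨rfl | hd, -, hne⟩ := S.active_spec y i h
  · exact hne
  · exact List.ne_nil_of_length_pos ((List.length_pos_of_ne_nil hne).trans_le hd.length_le)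

/-- Every block that is to be brought to rest by force is so after finitely many steps. -/
theorem exists_phase_end (hF : ∀ n w, IsCompact (S.target n w)) {y : ℕ → Bool} {k : ℕ}
    {τ : SplitState} (ha : S.active (S.control y k) = some τ) :
    ∃ k' > k, (S.control y k').phase = none ∧
      (S.control y k').count = (S.control y k).count + 1 ∧
      (S.control y k').cur.stack = τ.pending ∧ (S.control y k').cur.left = τ.right ∧
      ∀ i, k ≤ i → i < k' → S.active (S.control y i) = some τ ∧
        (S.control y i).count = (S.control y k).count := by
  by_contra hno
  have hall : ∀ i ≥ k, ∀ j, k ≤ j → j ≤ i → S.active (S.control y j) = some τ ∧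
      (S.control y j).count = (S.control y k).count := by
    intro i hi
    induction i, hi using Nat.le_induction with
    | base =>
      intro j h1 h2
      obtain rfl := le_antisymm h1 h2
      exact ⟨ha, rfl⟩
    | succ i hi ih =>
      intro j h1 h2
      rcases Nat.le_succ_iff.1 h2 with h2 | rfl
      · exact ih j h1 h2
      · obtain ⟨ha', hc⟩ := ih i hi le_rfl
        rcases S.control_succ_cases ha' (S.active_spec y i ha').1 with
          ⟨h3, h4, -⟩ | ⟨h3, h4, h5, h6⟩
        · exact ⟨S.active_of_phase_eq_some h3, h4.trans hc⟩
        · exact absurd ⟨i + 1, by omega, h3, by rw [h4, hc], h5, h6,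
            fun m hm hm' => ih m hm (by omega)⟩ hno
  -- In an endless phase the positions eventually avoid the compact target, so every bit is `true`
  -- and the stack shrinks at each step, which is impossible.
  obtain ⟨N, hN⟩ := eventually_loc_notMem (S.steer y) (hF (S.control y k).count τ.width)
  set i₀ := max N k
  have hdec : ∀ j, (S.control y (i₀ + j)).cur.pending.length + j =
      (S.control y i₀).cur.pending.length := by
    intro j
    induction j with
    | zero => rfl
    | succ j ih =>
      obtain ⟨ha', hc⟩ := hall (i₀ + j) (by omega) _ (by omega) le_rfl
      have hloc := hN (S.time + (i₀ + j)) (by omega)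
      rw [run_steer, ← hc] at hloc
      obtain ⟨⟨e, p⟩, l, hl⟩ := List.exists_cons_of_ne_nil (S.pending_ne_nil_of_active ha')
      have hcur : (S.control y (i₀ + (j + 1))).cur =
          (S.control y (i₀ + j)).cur.step (S.bit (S.control y (i₀ + j)) (y (i₀ + j))) :=
        cur_next S _ _
      rw [show S.bit (S.control y (i₀ + j)) (y (i₀ + j)) = true by simp [bit, ha', hloc],
        step_of_pending hl] at hcur
      rw [hl] at ih
      rw [hcur]
      simp only [List.length_cons] at ih ⊢
      omega
  have := hdec ((S.control y i₀).cur.pending.length + 1)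
  omega

/-- Widths tend to `0`, so only an empty `pending` could prevent a start forever; but such a state
is cut, which makes `pending` nonempty at the next step. -/
theorem exists_phase_start (hT : ∀ n, 0 < S.threshold n) {y : ℕ → Bool} {k : ℕ}
    (hk : (S.control y k).phase = none) :
    ∃ k' ≥ k, (S.control y k').count = (S.control y k).count ∧
      S.active (S.control y k') = some (S.control y k').cur := by
  by_contra! hno
  have hall : ∀ i ≥ k, (S.control y i).phase = none ∧
      (S.control y i).count = (S.control y k).count ∧ S.active (S.control y i) = none := by
    have key : ∀ i ≥ k, (S.control y i).phase = none →
        (S.control y i).count = (S.control y k).count → S.active (S.control y i) = none := by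
      intro i hi h1 h2
      rcases ha : S.active (S.control y i) with _ | τ
      · rfl
      · refine absurd ?_ (hno i hi h2)
        rw [ha, (S.active_of_phase_eq_none h1 ha).1]
    intro i hi
    induction i, hi using Nat.le_induction with
    | base => exact ⟨hk, rfl, key k le_rfl hk rfl⟩
    | succ i hi ih =>
      have hs := S.control_succ_of_active_eq_none ih.2.2
      have h1 : (S.control y (i + 1)).phase = none := by rw [hs]
      have h2 : (S.control y (i + 1)).count = (S.control y k).count := by rw [hs]; exact ih.2.1
      exact ⟨h1, h2, key (i + 1) (by omega) h1 h2⟩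
  obtain ⟨N, hN⟩ := eventually_width_lt (S.steer y) (hT (S.control y k).count)
  have hnil : ∀ i ≥ max N k, (S.control y i).cur.pending = [] := by
    intro i hi
    obtain ⟨h1, h2, h3⟩ := hall i ((le_max_right _ _).trans hi)
    by_contra hne
    have hw := hN (S.time + i) (by omega)
    rw [run_steer, ← h2] at hw
    simp [active, h1, hw.le, hne] at h3
  have h0 := hnil (max N k) le_rfl
  have h1 := hnil (max N k + 1) (Nat.le_succ _)
  rw [S.control_succ_of_active_eq_none (hall _ (le_max_right _ _)).2.2] at h1
  simp only [step_of_eq_nil h0] at h1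
  simp [split] at h1

theorem exists_phase (hT : ∀ n, 0 < S.threshold n) (hF : ∀ n w, IsCompact (S.target n w))
    (y : ℕ → Bool) (n : ℕ) :
    ∃ k, (S.control y k).count = n ∧
      S.active (S.control y k) = some (S.control y k).cur := by
  suffices h : ∃ k, (S.control y k).phase = none ∧ (S.control y k).count = n by
    obtain ⟨k, h1, rfl⟩ := h
    obtain ⟨k', -, h⟩ := S.exists_phase_start hT h1
    exact ⟨k', h⟩
  induction n with
  | zero => exact ⟨0, rfl, rfl⟩
  | succ n ih =>
    obtain ⟨k, h1, rfl⟩ := ih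
    obtain ⟨k', -, h2, h3⟩ := S.exists_phase_start hT h1
    obtain ⟨k'', -, h4, h5, -⟩ := S.exists_phase_end hF h3
    exact ⟨k'', h4, by rw [h5, h2]⟩

/-! ### Forced mass and free mass -/

theorem bit_eq_true_of_left_lt {y : ℕ → Bool} {i : ℕ}
    (h : (S.control y i).cur.left < (S.control y (i + 1)).cur.left) :
    S.bit (S.control y i) (y i) = true := by
  rw [show (S.control y (i + 1)).cur =
    (S.control y i).cur.step (S.bit (S.control y i) (y i)) from cur_next S _ _] at h
  rcases step_cases (S.control y i).cur (S.bit (S.control y i) (y i)) with ⟨hs, -⟩ | ⟨hb, -⟩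
  · rw [hs] at h
    exact absurd h (lt_irrefl _)
  · exact hb

/-- During the `n`-th phase the frontier sweeps exactly the forced block, and it advances only when
the piece lands outside the target. -/
theorem exists_width_le_law (hT : ∀ n, 0 < S.threshold n) (hF : ∀ n w, IsCompact (S.target n w))
    (y : ℕ → Bool) (n : ℕ) :
    ∃ w > 0, ENNReal.ofReal w ≤ (law (S.steer y) : Measure ℚ) (S.target n w)ᶜ := by
  obtain ⟨k, rfl, ha⟩ := S.exists_phase hT hF y n
  obtain ⟨k', hk', -, -, -, hl, hin⟩ := S.exists_phase_end hF ha
  refine ⟨(S.control y k).cur.width, sub_pos.2 (S.left_lt_right_control y k), ?_⟩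
  convert sum_le_law_compl (S.steer y) (G := Finset.Ico (S.time + k) (S.time + k')) ?_ using 2
  · rw [Finset.sum_Ico_sub (fun i => (run (S.steer y) i).left) (by omega), run_steer, run_steer,
      hl, width]
  · intro i hi hlt
    obtain ⟨h1, h2⟩ := Finset.mem_Ico.1 hi
    obtain ⟨j, rfl⟩ := Nat.exists_eq_add_of_le ((Nat.le_add_right S.time k).trans h1)
    obtain ⟨h3, h4⟩ := hin j (by omega) (by omega)
    rw [add_assoc, run_steer, run_steer] at hlt
    rw [run_steer, ← h4]
    have := S.bit_eq_true_of_left_lt hlt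
    simpa [bit, h3] using this

open Classical in
/-- The mass brought to rest by force is bounded by the thresholds. -/
theorem sum_forced_le (y : ℕ → Bool) (k : ℕ) :
    ∑ i ∈ (Finset.range k).filter (fun i => S.active (S.control y i) ≠ none),
        ((S.control y (i + 1)).cur.left - (S.control y i).cur.left) ≤
      ∑ n ∈ Finset.range (S.control y k).count, S.threshold n +
        (match (S.control y k).phase with
          | none => 0
          | some τ => (S.control y k).cur.left - τ.left) := by
  induction k with
  | zero => simp [control]
  | succ k ih =>
    rw [Finset.range_add_one, Finset.filter_insert]
    rcases ha : S.active (S.control y k) with _ | τ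
    · simp only [ne_eq, not_true_eq_false, if_false]
      rw [S.phase_eq_none_of_active_eq_none ha] at ih
      rw [S.control_succ_of_active_eq_none ha]
      exact ih
    · obtain ⟨hd, hw, -⟩ := S.active_spec y k ha
      have ih' : ∑ i ∈ (Finset.range k).filter (fun i => S.active (S.control y i) ≠ none),
          ((S.control y (i + 1)).cur.left - (S.control y i).cur.left) ≤
          ∑ n ∈ Finset.range (S.control y k).count, S.threshold n +
            ((S.control y k).cur.left - τ.left) := by
        rcases hp : (S.control y k).phase with _ | τ'
        · rw [hp] at ih
          rw [(S.active_of_phase_eq_none hp ha).1, sub_self]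
          exact ih
        · rw [hp] at ih
          obtain rfl : τ' = τ := Option.some.inj ((S.active_of_phase_eq_some hp).symm.trans ha)
          exact ih
      rw [if_pos (by simp), Finset.sum_insert (by simp)]
      rcases S.control_succ_cases ha hd with ⟨h1, h2, -⟩ | ⟨h1, h2, -, h3⟩
      · rw [h1, h2]
        simp only
        linarith
      · rw [h1, h2, h3, Finset.sum_range_succ]
        simp only [width] at hw ⊢
        linarith

/-- If the free bits bring all late blocks to rest, then the frontier tends to `1`. -/
theorem exists_lt_left (hF : ∀ n w, IsCompact (S.target n w)) {y : ℕ → Bool}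
    {N : ℕ} (hy : ∀ i ≥ N, y i = true) {η : ℝ} (hη : 0 < η) :
    ∃ k, (S.control y k).phase = none ∧ 1 - η < (S.control y k).cur.left := by
  obtain ⟨M, hM⟩ := eventually_width_lt (S.steer y) hη
  have hnone : ∀ m, ∃ k ≥ m, (S.control y k).phase = none := by
    intro m
    rcases hp : (S.control y m).phase with _ | τ
    · exact ⟨m, le_rfl, hp⟩
    · obtain ⟨k, hk, h, -⟩ := S.exists_phase_end hF (S.active_of_phase_eq_some hp)
      exact ⟨k, hk.le, h⟩
  -- Induction on the stack height between phases: a free bit `true` and a completed phase each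
  -- lower it by one. When `pending` is empty, the active block ends at `1` and has width below `η`.
  suffices h : ∀ n, ∀ k ≥ max N M, (S.control y k).phase = none →
      (S.control y k).cur.pending.length = n →
      ∃ k' ≥ max N M, (S.control y k').phase = none ∧ (S.control y k').cur.pending = [] by
    obtain ⟨k, hk, hp⟩ := hnone (max N M)
    obtain ⟨k', hk', hp', hnil⟩ := h _ k hk hp rfl
    refine ⟨k', hp', ?_⟩
    have hw := hM (S.time + k') (by omega)
    rw [width, right_eq_one (by rw [run_steer]; exact hnil), run_steer] at hw
    linarith
  intro n
  induction n with
  | zero => exact fun k hk hp hn => ⟨k, hk, hp, List.eq_nil_of_length_eq_zero hn⟩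
  | succ n ih =>
    intro k hk hp hn
    rcases ha : S.active (S.control y k) with _ | τ
    · obtain ⟨⟨e, p⟩, l, hl⟩ := List.exists_cons_of_length_eq_add_one hn
      have hs := S.control_succ_of_active_eq_none ha
      rw [hy k (by omega), step_of_pending hl] at hs
      refine ih (k + 1) (by omega) (by rw [hs]) ?_
      rw [hs]
      rw [hl] at hn
      simpa using hn
    · obtain ⟨k', hk', h1, -, h2, -⟩ := S.exists_phase_end hF ha
      refine ih k' (by omega) h1 ?_
      have := congrArg List.length h2
      rw [(S.active_of_phase_eq_none hp ha).1, hn] at this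
      simpa [stack] using this

open Classical in
/-- The states that arise if every free block outside `F` is brought to rest. -/
noncomputable def greedyControl (F : Set ℚ) : ℕ → ControlState
  | 0 => ⟨run S.init S.time, 0, none⟩
  | k + 1 => S.next (greedyControl F k) (decide ((greedyControl F k).cur.loc ∉ F))

open Classical in
theorem exists_greedy (F : Set ℚ) : ∃ y : ℕ → Bool, ∀ i,
    y i = decide ((S.control y i).cur.loc ∉ F) := by
  refine ⟨fun i => decide ((S.greedyControl F i).cur.loc ∉ F), fun i => ?_⟩
  have h : ∀ i, S.control (fun i => decide ((S.greedyControl F i).cur.loc ∉ F)) i =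
      S.greedyControl F i := by
    intro i
    induction i with
    | zero => rfl
    | succ i ih => rw [control, ih, greedyControl]
  rw [h i]

/-- With greedy free bits the frontier passes `1 - η`. Of the mass it sweeps, at most `c` is forced;
the rest settles outside `F`. -/
theorem exists_le_law_compl {c : ℝ}
    (hc : ∀ N, ∑ n ∈ Finset.range N, S.threshold n ≤ c)
    (hF : ∀ n w, IsCompact (S.target n w)) {F : Set ℚ} (hFc : IsCompact F) {η : ℝ} (hη : 0 < η) :
    ∃ y, ENNReal.ofReal (1 - (run S.init S.time).left - c - η) ≤
      (law (S.steer y) : Measure ℚ) Fᶜ := by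
  classical
  obtain ⟨y, hy⟩ := S.exists_greedy F
  refine ⟨y, ?_⟩
  obtain ⟨N, hN⟩ := eventually_loc_notMem (S.steer y) hFc
  obtain ⟨k, hp, hk⟩ := S.exists_lt_left hF (y := y) (N := N) (fun i hi => by
    have := hN (S.time + i) (by omega)
    rw [run_steer] at this
    rw [hy i]
    exact decide_eq_true this) hη
  have hforced := S.sum_forced_le y k
  rw [hp] at hforced
  have hsum := Finset.sum_filter_add_sum_filter_not (Finset.range k)
    (fun i => S.active (S.control y i) ≠ none)
    (fun i => (S.control y (i + 1)).cur.left - (S.control y i).cur.left)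
  rw [Finset.sum_range_sub (fun i => (S.control y i).cur.left)] at hsum
  have hc' := hc (S.control y k).count
  have h0 : (S.control y 0).cur.left = (run S.init S.time).left := rfl
  refine le_trans (ENNReal.ofReal_le_ofReal ?_) (sum_le_law_compl (S.steer y)
    (G := ((Finset.range k).filter fun i => ¬ S.active (S.control y i) ≠ none).map
      (addLeftEmbedding S.time)) ?_)
  · rw [Finset.sum_map]
    simp only [addLeftEmbedding_apply, add_assoc, run_steer]
    simp only [add_zero] at hforced
    linarith
  · intro j hj hlt
    obtain ⟨i, hi, rfl⟩ := Finset.mem_map.1 hj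
    have ha := not_not.1 (Finset.mem_filter.1 hi).2
    simp only [addLeftEmbedding_apply, add_assoc, run_steer] at hlt ⊢
    have hb := S.bit_eq_true_of_left_lt hlt
    simp only [bit, ha] at hb
    rw [hy i] at hb
    exact of_decide_eq_true hb

end Steering

/-! ### Avoiding tight sets inside a cylinder -/

open SplitState

/-- Every cylinder contains a compact set of parameters whose laws are not uniformly tight and
avoid given countably many uniformly tight sets. -/
theorem exists_isCompact_not_uniformlyTight (x : ℕ → Bool) (k : ℕ)
    {A : ℕ → Set (ProbabilityMeasure ℚ)} (hA : ∀ n, UniformlyTight (A n)) :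
    ∃ D : Set (ℕ → Bool), IsCompact D ∧ (∀ y ∈ D, ∀ i < k, y i = x i) ∧
      (∀ y ∈ D, ∀ n, law y ∉ A n) ∧ ¬ UniformlyTight (law '' D) := by
  -- A law with mass at least `w` outside this set cannot lie in `A n`, since `w / 2 < w`. The set
  -- depends on `w` because the width of the forced block is not known beforehand.
  have hF : ∀ n (w : ℝ), ∃ F : Set ℚ, IsCompact F ∧
      (0 < w → ∀ μ ∈ A n, (μ : Measure ℚ) Fᶜ ≤ ENNReal.ofReal (w / 2)) := by
    intro n w
    by_cases hw : 0 < w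
    · obtain ⟨F, hFc, h⟩ := isTightMeasureSet_iff_exists_isCompact_measure_compl_le.1 (hA n)
        (ENNReal.ofReal (w / 2)) (ENNReal.ofReal_pos.2 (half_pos hw))
      exact ⟨F, hFc, fun _ μ hμ => h _ ⟨μ, hμ, rfl⟩⟩
    · exact ⟨∅, isCompact_empty, fun h => absurd h hw⟩
  choose F hFc hF using hF
  set d := 1 - (run x k).left with hd
  have hd0 : 0 < d := sub_pos.2 (left_lt_one x k)
  -- The thresholds sum to at most `d / 2`, half of the mass not yet passed by the frontier at time
  -- `k`.
  let S : Steering := ⟨fun n => d / 2 * (1 / 2) ^ (n + 1), F, x, k⟩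
  have hT : ∀ n, 0 < S.threshold n := fun n => by
    simp only [S]
    positivity
  have hsum : ∀ N, ∑ n ∈ Finset.range N, S.threshold n ≤ d / 2 := by
    intro N
    have h : ∑ n ∈ Finset.range N, S.threshold n = d / 2 * (1 - (1 / 2) ^ N) := by
      induction N with
      | zero => simp
      | succ N ih =>
        rw [Finset.sum_range_succ, ih]
        simp only [S]
        ring
    rw [h]
    have : (0 : ℝ) < (1 / 2) ^ N := by positivity
    nlinarith
  refine ⟨range S.steer, isCompact_range S.continuous_steer, ?_, ?_, ?_⟩
  · rintro _ ⟨y, rfl⟩ i hi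
    exact if_pos hi
  · rintro _ ⟨y, rfl⟩ n hmem
    obtain ⟨w, hw, hle⟩ := S.exists_width_le_law hT hFc y n
    have := hle.trans (hF n w hw _ hmem)
    rw [ENNReal.ofReal_le_ofReal_iff (by linarith)] at this
    linarith
  · intro ht
    obtain ⟨E, hE, h⟩ := isTightMeasureSet_iff_exists_isCompact_measure_compl_le.1 ht
      -- Greedy steering leaves at least `d - d / 2 - d / 4 = d / 4` outside `E`, more than `d / 8`.
      (ENNReal.ofReal (d / 8)) (ENNReal.ofReal_pos.2 (by linarith))
    obtain ⟨y, hy⟩ := S.exists_le_law_compl hsum hFc hE (η := d / 4) (by linarith)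
    have := hy.trans (h _ ⟨law (S.steer y), ⟨_, ⟨y, rfl⟩, rfl⟩, rfl⟩)
    rw [ENNReal.ofReal_le_ofReal_iff (by linarith)] at this
    simp only [S] at this
    linarith

/-- `ProbabilityMeasure ℚ` carries the topology of weak convergence, and `ℚ` its usual topology
with the Borel σ-algebra. A nonempty relatively open subset of `K` is `U ∩ K` with `U` open. -/
theorem theorem1p3 :
    ∃ K : Set (ProbabilityMeasure ℚ), K.Nonempty ∧ IsCompact K ∧
      (∀ μ ∈ K, LocallyCompactSpace (μ : Measure ℚ).support) ∧
      (∀ μ ∈ K, ∀ ν ∈ K, μ ≠ ν →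
        ((μ : Measure ℚ).support ∩ (ν : Measure ℚ).support).Finite) ∧
      (∀ U : Set (ProbabilityMeasure ℚ), IsOpen U → (U ∩ K).Nonempty →
        ∃ L : Set (ProbabilityMeasure ℚ), L ⊆ U ∩ K ∧ IsCompact L ∧
          ∀ A : Set (ProbabilityMeasure ℚ), A ⊆ K → SigmaUniformlyTight A →
            ∃ C : Set (ProbabilityMeasure ℚ), C ⊆ L \ A ∧ IsCompact C ∧ ¬ UniformlyTight C) := by
  refine ⟨range law, range_nonempty _, isCompact_range continuous_law, ?_, ?_, ?_⟩
  · rintro _ ⟨x, rfl⟩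
    have := discreteTopology_support_law x
    infer_instance
  · rintro _ ⟨x, rfl⟩ _ ⟨y, rfl⟩ hne
    exact finite_inter_support_law fun h => hne (by rw [h])
  · rintro U hU ⟨_, hxU, x, rfl⟩
    obtain ⟨V, ⟨z, k, rfl⟩, hxV, hVU⟩ :=
      (PiNat.isTopologicalBasis_cylinders (fun _ : ℕ => Bool)).exists_subset_of_mem_open
        (show x ∈ law ⁻¹' U from hxU) (hU.preimage continuous_law)
    rw [← PiNat.mem_cylinder_iff_eq.1 hxV] at hVU
    -- The set `L` is fixed before `A`: steering works inside every cylinder because it leaves the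
    -- first `k` bits alone.
    refine ⟨law '' PiNat.cylinder x k, ?_, ?_, ?_⟩
    · rintro _ ⟨y, hy, rfl⟩
      exact ⟨hVU hy, y, rfl⟩
    · rw [PiNat.cylinder_eq_pi]
      exact (isClosed_set_pi fun _ _ => isClosed_discrete _).isCompact.image continuous_law
    · rintro A - ⟨B, hB, hAB⟩
      obtain ⟨D, hD, hDx, hDB, hDt⟩ := exists_isCompact_not_uniformlyTight x k hB
      refine ⟨law '' D, ?_, hD.image continuous_law, hDt⟩
      rintro _ ⟨y, hy, rfl⟩
      refine ⟨⟨y, hDx y hy, rfl⟩, fun hA => ?_⟩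
      obtain ⟨n, hn⟩ := mem_iUnion.1 (hAB hA)
      exact hDB y hy n hn
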